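/- For an odd integer $p\ge 3$, call a triple $(a,b,c)$ of non-negative integers $p$-admissible if $a+b+c$ is even, $a\le b+c$, $b\le a+c$, $c\le a+b$ and $a+b+c\le 2p-4$. For $g\ge 1$ and an even integer $a$ with $0\le a\le p-3$, let $V_p(\Sigma_g,a)$ be the $SO(3)$-TQFT vector space (at a primitive $2p$-th root of unity) of the closed oriented surface $\Sigma_g$ of genus $g$ with one point colored $a$, and let $D_g^{(a)}=\dim V_p(\Sigma_g,a)$ ($p$ being suppressed from the notation). Here $V_p(\Sigma_g,a)$ is the complex vector space with basis the $p$-admissible colorings of a lollipop tree (a trivalent spine of the genus $g$ handlebody with $g$ loops and exactly one free end): the colorings of its edges by elements of $\{0,2,\dots,p-3\}$ such that the free end has color $a$ and the three edge-ends at each trivalent vertex have $p$-admissible colors. Lemma. Let $g\ge 1$ and $\mathcal E=\{g-1,g+1,\dots,3g-3\}=\{g-1+2k \mid k=0,1,\dots,g-1\}$. There are polynomials $\widetilde\varphi_j\in\mathbb Q[x]$ ($j\in\mathcal E$), depending only on $g$, such that $\widetilde\varphi_j$ has degree exactly $3g-2-j$ for each $j\in\mathcal E$ and $$D_g^{(p-2s-1)}=\sum_{j\in\mathcal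 E}\widetilde\varphi_j(s)\,p^j$$ for all odd $p\ge 3$ and all integers $s$ with $1\le s\le (p-1)/2$. -/

import Mathlib

open Polynomial

/-- A triple of colors `(a, b, c)` is `p`-admissible if it has even sum, satisfies the triangle
inequalities, and `a + b + c ≤ 2p - 4`. -/
def PAdmissible (p a b c : ℕ) : Prop :=
  Even (a + b + c) ∧ a ≤ b + c ∧ b ≤ a + c ∧ c ≤ a + b ∧ a + b + c + 4 ≤ 2 * p

/-- The colors of the `SO(3)`-TQFT at a primitive `2p`-th root of unity (`p` odd): the even
integers in `{0, 1, …, p - 2}`, that is `0, 2, …, p - 3`. -/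
abbrev SOColor (p : ℕ) : Type := {a : Fin (p - 1) // Even (a : ℕ)}

/-- The underlying integer of a color. -/
def SOColor.val {p : ℕ} (a : SOColor p) : ℕ := (a.1 : ℕ)

/-- `p`-admissible even colorings of the lollipop tree of genus `g` whose only free end (the leg)
is colored `a`.

The lollipop tree is the uni-trivalent graph consisting of a trunk with edges `0, 1, …, g` and
of `g` sticks, each ending in a loop. Stick `i` starts at the trunk vertex between the trunk
edges `i` and `i + 1`, and ends at the vertex of loop `i`. The trunk edge `0` is the leg. The
trunk edge `g` is colored `0`, that is, it is absent: the last trunk vertex is then just a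
point where the trunk edge `g - 1` turns into the stick `g - 1`, and admissibility at it says
that these two have the same color. So this is the connected graph with first Betti number `g`,
exactly one univalent vertex, and `2g - 1` trivalent vertices (for `g ≥ 1`): it is a spine of
the handlebody of genus `g`, with its leg ending in the colored point on the boundary. -/
@[ext]
structure LollipopColoring (p g a : ℕ) where
  trunk : Fin (g + 1) → SOColor p
  stick : Fin g → SOColor p
  loop : Fin g → SOColor p
  trunk_zero : (trunk 0).val = a
  trunk_last : (trunk (Fin.last g)).val = 0
  admissible_trunk : ∀ i : Fin g,
    PAdmissible p (trunk i.castSucc).val (stick i).val (trunk i.succ).val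
  admissible_loop : ∀ i : Fin g, PAdmissible p (stick i).val (loop i).val (loop i).val

/-- The `SO(3)`-TQFT vector space `V_p(Σ_g, a)` of the closed surface of genus `g` with one point
colored `a` (`p` odd, `a` even): the complex vector space with basis the `p`-admissible even
colorings of the lollipop tree of genus `g` with leg colored `a`. -/
abbrev VSpace (p g a : ℕ) : Type := LollipopColoring p g a →₀ ℂ

/-- There are finitely many colorings, so that the dimension below is a true dimension. -/
instance (p g a : ℕ) : Finite (LollipopColoring p g a) :=
  Finite.of_injective
    (fun x : LollipopColoring p g a => (x.trunk, x.stick, x.loop)) (by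
      intro x y h
      simp only [Prod.mk.injEq] at h
      exact LollipopColoring.ext h.1 h.2.1 h.2.2)

/-- `D_g^{(a)}`, the dimension of `V_p(Σ_g, a)`. -/
noncomputable def verlindeDim (p g a : ℕ) : ℕ := Module.finrank ℂ (VSpace p g a)

/-- The set of exponents `{g - 1, g + 1, …, 3g - 3}` (used for `g ≥ 1`). -/
def exponentSet (g : ℕ) : Finset ℕ := (Finset.range g).image fun k => g - 1 + 2 * k

/-! Write p = 2n + 1 and the colors as 2n - 2t with 1 ≤ t ≤ n. Cutting off the first handle of the
lollipop tree gives D_{g+1}(s) = ∑_t K(s,t) D_g(t) with K(s,t) = p min(s,t) - 2st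
(`verlindeDim_succ`), and D_1(s) = s. K / p is the Green kernel of minus the second difference, with
conditions f(0) = 0 and f(n) + f(n+1) = 0 (`sum_green_kernel`). The central binomials β_m =
binom(x+m, 2m+1) vanish at 0, and the second difference of β_{m+1} is β_m. So K sends β_m to -p
β_{m+1} plus a multiple of β_0 = x, and by induction D_{r+1} = p^r ∑_m (-1)^m d_{r-m}(p²) β_m
(`verlindeDim_formula`), with d_r of degree at most r. The coefficient of p^{r+2k} is then a
combination of the β_m with m ≤ r - k, so its degree is exactly 2(r-k) + 1 once the x^k coefficient
c_k of d_k is nonzero. In fact c_k > 0: these are the Taylor coefficients of (z/2) / sin(z/2), and a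
concavity argument gives positivity (`coeff_pos_of_recursion`). -/

/-! ### Counting colorings by removing one handle -/

theorem verlindeDim_eq_card (p g a : ℕ) : verlindeDim p g a = Nat.card (LollipopColoring p g a) := by
  classical
  have := Fintype.ofFinite (LollipopColoring p g a)
  rw [verlindeDim, Module.finrank_finsupp_self, Nat.card_eq_fintype_card]

theorem SOColor.val_injective {p : ℕ} : Function.Injective (SOColor.val (p := p)) :=
  fun _ _ h => Subtype.ext (Fin.ext h)

/-- A genus `g + 1` coloring is a coloring of the first trunk vertex and of the first loop, followed
by a genus `g` coloring. -/
def LollipopColoring.succEquiv (p g : ℕ) (a : SOColor p) :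
    LollipopColoring p (g + 1) a.val ≃
      Σ x : SOColor p × {cl : SOColor p × SOColor p //
        PAdmissible p cl.1.val cl.2.val cl.2.val},
        {_y : LollipopColoring p g x.1.val // PAdmissible p a.val x.2.1.1.val x.1.val} where
  toFun f := ⟨(f.trunk 1, ⟨(f.stick 0, f.loop 0), f.admissible_loop 0⟩),
    ⟨{  trunk := fun i => f.trunk i.succ
        stick := fun i => f.stick i.succ
        loop := fun i => f.loop i.succ
        trunk_zero := rfl
        trunk_last := f.trunk_last
        admissible_trunk := fun i => f.admissible_trunk i.succ
        admissible_loop := fun i => f.admissible_loop i.succ },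
      by
        have h := f.admissible_trunk 0
        rwa [Fin.castSucc_zero, f.trunk_zero] at h⟩⟩
  invFun z :=
    { trunk := Fin.cons a z.2.1.trunk
      stick := Fin.cons z.1.2.1.1 z.2.1.stick
      loop := Fin.cons z.1.2.1.2 z.2.1.loop
      trunk_zero := rfl
      trunk_last := z.2.1.trunk_last
      admissible_trunk := by
        intro i
        refine Fin.cases ?_ (fun i => ?_) i
        · have h := z.2.2
          rw [← z.2.1.trunk_zero] at h
          exact h
        · exact z.2.1.admissible_trunk i
      admissible_loop := by
        intro i
        refine Fin.cases ?_ (fun i => ?_) i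
        · exact z.1.2.2
        · exact z.2.1.admissible_loop i }
  left_inv f := by
    ext1
    · funext i
      refine Fin.cases ?_ (fun i => rfl) i
      exact SOColor.val_injective f.trunk_zero.symm
    · funext i
      exact Fin.cases rfl (fun i => rfl) i
    · funext i
      exact Fin.cases rfl (fun i => rfl) i
  right_inv z := by
    obtain ⟨⟨b, c⟩, ⟨trunk, stick, loop, h0, hl, ht, hlo⟩, hy⟩ := z
    obtain rfl : trunk 0 = b := SOColor.val_injective h0
    rfl

open Classical in
theorem card_lollipopColoring_succ (p g : ℕ) (a : SOColor p) :
    Nat.card (LollipopColoring p (g + 1) a.val) =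
      ∑ b : SOColor p, (∑ c : SOColor p, if PAdmissible p a.val c.val b.val then
        (∑ l : SOColor p, if PAdmissible p c.val l.val l.val then 1 else 0) else 0) *
        Nat.card (LollipopColoring p g b.val) := by
  rw [Nat.card_congr (LollipopColoring.succEquiv p g a), Nat.card_sigma, Fintype.sum_prod_type]
  refine Finset.sum_congr rfl fun b _ => ?_
  have h1 : ∀ c : {cl : SOColor p × SOColor p // PAdmissible p cl.1.val cl.2.val cl.2.val},
      Nat.card {_y : LollipopColoring p g b.val // PAdmissible p a.val c.1.1.val b.val} =
        (if PAdmissible p a.val c.1.1.val b.val then 1 else 0) *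
          Nat.card (LollipopColoring p g b.val) := by
    intro c
    split_ifs with h <;> simp [h]
  rw [Finset.sum_congr rfl fun c _ => h1 c, ← Finset.sum_mul]
  congr 1
  rw [← Finset.sum_subtype (Finset.univ.filter fun cl : SOColor p × SOColor p =>
      PAdmissible p cl.1.val cl.2.val cl.2.val) (by simp)
      (fun cl => if PAdmissible p a.val cl.1.val b.val then 1 else 0), Finset.sum_filter,
    Fintype.sum_prod_type]
  refine Finset.sum_congr rfl fun c _ => ?_
  split_ifs <;> simp

theorem card_lollipopColoring_zero (p : ℕ) (a : SOColor p) :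
    Nat.card (LollipopColoring p 0 a.val) = if a.val = 0 then 1 else 0 := by
  split_ifs with h
  · rw [Nat.card_eq_one_iff_unique]
    refine ⟨⟨fun x y => ?_⟩, ⟨⟨fun _ => a, Fin.elim0, Fin.elim0, rfl, h, fun i => i.elim0,
      fun i => i.elim0⟩⟩⟩
    ext1
    · funext i
      obtain rfl : i = 0 := Fin.ext (by omega)
      exact SOColor.val_injective (x.trunk_zero.trans y.trunk_zero.symm)
    · exact Subsingleton.elim _ _
    · exact Subsingleton.elim _ _
  · rw [Nat.card_eq_zero]
    exact Or.inl ⟨fun x => h (x.trunk_zero.symm.trans x.trunk_last)⟩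

/-! ### The transfer kernel K(s,t) = p min(s,t) - 2st -/

/-- The color `2n - 2t` for `p = 2n + 1`. -/
def SOColor.ofIndex (n t : ℕ) (h : 1 ≤ t) (hn : t ≤ n) : SOColor (2 * n + 1) :=
  ⟨⟨2 * n - 2 * t, by omega⟩, ⟨n - t, by simp only; omega⟩⟩

theorem sum_SOColor {M : Type*} [AddCommMonoid M] (n : ℕ) (f : ℕ → M) :
    ∑ b : SOColor (2 * n + 1), f b.val = ∑ t ∈ Finset.Icc 1 n, f (2 * n - 2 * t) := by
  symm
  refine Finset.sum_bij (fun t ht => SOColor.ofIndex n t (Finset.mem_Icc.1 ht).1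
    (Finset.mem_Icc.1 ht).2) (fun _ _ => Finset.mem_univ _) ?_ ?_ (fun _ _ => rfl)
  · intro t ht u hu h
    have h' : 2 * n - 2 * t = 2 * n - 2 * u := congrArg SOColor.val h
    simp only [Finset.mem_Icc] at ht hu
    omega
  · intro b _
    obtain ⟨k, hk⟩ := b.2
    have hb := b.1.2
    refine ⟨n - k, Finset.mem_Icc.2 ⟨by omega, by omega⟩, SOColor.val_injective ?_⟩
    change 2 * n - 2 * (n - k) = (b.1 : ℕ)
    omega

open Classical in
theorem sum_loop (n u : ℕ) (h1 : 1 ≤ u) (hu : u ≤ n) :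
    (∑ t ∈ Finset.Icc 1 n, if PAdmissible (2 * n + 1) (2 * n - 2 * u) (2 * n - 2 * t)
      (2 * n - 2 * t) then 1 else 0) = u := by
  rw [← Finset.card_filter]
  -- The lower end comes from the bound 2p - 4 on the sum, the upper end from the triangle
  -- inequality.
  have : (Finset.Icc 1 n).filter (fun t => PAdmissible (2 * n + 1) (2 * n - 2 * u)
      (2 * n - 2 * t) (2 * n - 2 * t)) = Finset.Icc ((n + 2 - u) / 2) ((n + u) / 2) := by
    ext t
    simp only [Finset.mem_filter, Finset.mem_Icc, PAdmissible, Nat.even_iff]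
    omega
  rw [this, Nat.card_Icc]
  omega

theorem sum_Icc_natCast (m M : ℕ) (h : m ≤ M + 1) :
    (∑ u ∈ Finset.Icc m M, (u : ℚ)) = (M * (M + 1) - m * (m - 1)) / 2 := by
  induction M with
  | zero =>
    interval_cases m <;> simp
  | succ M ih =>
    rcases Nat.lt_or_ge (M + 1) m with h' | h'
    · obtain rfl : m = M + 2 := by omega
      rw [Finset.Icc_eq_empty (by omega)]
      push_cast
      simp
      ring
    · rw [Finset.sum_Icc_succ_top h', ih h']
      push_cast
      ring

open Classical in
theorem sum_handle (n s t : ℕ) (hs1 : 1 ≤ s) (hs : s ≤ n) (ht1 : 1 ≤ t) (ht : t ≤ n) :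
    (∑ u ∈ Finset.Icc 1 n, if PAdmissible (2 * n + 1) (2 * n - 2 * s) (2 * n - 2 * u)
      (2 * n - 2 * t) then (u : ℚ) else 0) = (2 * n + 1) * min (s : ℚ) t - 2 * s * t := by
  rw [← Finset.sum_filter]
  have key : (Finset.Icc 1 n).filter (fun u => PAdmissible (2 * n + 1) (2 * n - 2 * s)
      (2 * n - 2 * u) (2 * n - 2 * t)) =
      Finset.Icc (max (n + 1 - (s + t)) (s + t - n)) (n + min s t - max s t) := by
    ext u
    simp only [Finset.mem_filter, Finset.mem_Icc, PAdmissible, Nat.even_iff]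
    omega
  rw [key, sum_Icc_natCast _ _ (by omega)]
  -- The two candidates for the lower end are m and 1 - m, and m(m - 1) is invariant under m ↦ 1 -
  -- m. So the sum has one formula in both cases.
  have hm : ((max (n + 1 - (s + t)) (s + t - n) : ℕ) : ℚ) *
      ((max (n + 1 - (s + t)) (s + t - n) : ℕ) - 1) = (s + t - n) * (s + t - n - 1) := by
    rcases le_or_gt (s + t) n with h | h
    · obtain ⟨k, rfl⟩ := Nat.exists_eq_add_of_le h
      rw [show max (s + t + k + 1 - (s + t)) (s + t - (s + t + k)) = k + 1 by omega]
      push_cast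
      ring
    · obtain ⟨k, hk⟩ := Nat.exists_eq_add_of_le h.le
      rw [show max (n + 1 - (s + t)) (s + t - n) = k by omega]
      have : (s : ℚ) + t = n + k := mod_cast hk
      rw [this]
      ring
  rw [hm]
  rcases le_total s t with h | h
  · rw [min_eq_left h, max_eq_right h, min_eq_left (Nat.cast_le.2 h), Nat.cast_sub (by omega)]
    push_cast
    ring
  · rw [min_eq_right h, max_eq_left h, min_eq_right (Nat.cast_le.2 h), Nat.cast_sub (by omega)]
    push_cast
    ring

theorem verlindeDim_succ (n g s : ℕ) (hs1 : 1 ≤ s) (hs : s ≤ n) :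
    (verlindeDim (2 * n + 1) (g + 1) (2 * n - 2 * s) : ℚ) =
      ∑ t ∈ Finset.Icc 1 n, ((2 * n + 1) * min (s : ℚ) t - 2 * s * t) *
        verlindeDim (2 * n + 1) g (2 * n - 2 * t) := by
  classical
  have h := card_lollipopColoring_succ (2 * n + 1) g (SOColor.ofIndex n s hs1 hs)
  change Nat.card (LollipopColoring _ _ (2 * n - 2 * s)) = _ at h
  change _ = ∑ b : SOColor (2 * n + 1), (∑ c : SOColor (2 * n + 1),
    if PAdmissible (2 * n + 1) (2 * n - 2 * s) c.val b.val then _ else 0) * _ at h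
  rw [verlindeDim_eq_card, h, sum_SOColor n (fun b => (∑ c : SOColor (2 * n + 1),
    if PAdmissible (2 * n + 1) (2 * n - 2 * s) c.val b then
    (∑ l : SOColor (2 * n + 1), if PAdmissible (2 * n + 1) c.val l.val l.val then 1 else 0)
    else 0) * Nat.card (LollipopColoring (2 * n + 1) g b)), Nat.cast_sum]
  refine Finset.sum_congr rfl fun t ht => ?_
  rw [Finset.mem_Icc] at ht
  rw [sum_SOColor n (fun c => if PAdmissible (2 * n + 1) (2 * n - 2 * s) c (2 * n - 2 * t) then
    (∑ l : SOColor (2 * n + 1), if PAdmissible (2 * n + 1) c l.val l.val then 1 else 0)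
    else 0), Nat.cast_mul, verlindeDim_eq_card, ← sum_handle n s t hs1 hs ht.1 ht.2, Nat.cast_sum]
  congr 1
  refine Finset.sum_congr rfl fun u hu => ?_
  rw [Finset.mem_Icc] at hu
  rw [sum_SOColor n (fun l => if PAdmissible (2 * n + 1) (2 * n - 2 * u) l l then 1 else 0),
    sum_loop n u hu.1 hu.2]
  split_ifs <;> simp

theorem verlindeDim_zero (n t : ℕ) (ht1 : 1 ≤ t) (ht : t ≤ n) :
    verlindeDim (2 * n + 1) 0 (2 * n - 2 * t) = if t = n then 1 else 0 := by
  have h := card_lollipopColoring_zero (2 * n + 1) (SOColor.ofIndex n t ht1 ht)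
  change Nat.card (LollipopColoring _ _ (2 * n - 2 * t)) = if 2 * n - 2 * t = 0 then 1 else 0 at h
  rw [verlindeDim_eq_card, h]
  exact if_congr (by omega) rfl rfl

theorem verlindeDim_one (n s : ℕ) (hs1 : 1 ≤ s) (hs : s ≤ n) :
    (verlindeDim (2 * n + 1) 1 (2 * n - 2 * s) : ℚ) = s := by
  -- In genus 0 only the color 0, that is t = n, contributes, and K(s,n) = (2n+1)s - 2sn = s.
  rw [verlindeDim_succ n 0 s hs1 hs, Finset.sum_eq_single n]
  · rw [verlindeDim_zero n n (by omega) le_rfl, if_pos rfl, min_eq_left (Nat.cast_le.2 hs)]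
    push_cast
    ring
  · intro t ht htn
    rw [Finset.mem_Icc] at ht
    rw [verlindeDim_zero n t ht.1 ht.2, if_neg htn]
    simp
  · intro h
    exact absurd (Finset.mem_Icc.2 ⟨by omega, le_rfl⟩) h

/-! ### Green kernel and central binomials -/

/-- The kernel `p min(s,t) - 2st` inverts the negative second difference. -/
theorem sum_green_kernel (f : ℚ → ℚ) (h0 : f 0 = 0) (n s : ℕ) (hs : s ≤ n) :
    ∑ t ∈ Finset.Icc 1 n, ((2 * n + 1) * min (s : ℚ) t - 2 * s * t) *
      (f (t + 1) + f (t - 1) - 2 * f t) = s * (f n + f (n + 1)) - (2 * n + 1) * f s := by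
  have h1 : ∀ n : ℕ, ∑ t ∈ Finset.Icc 1 n, (t : ℚ) * (f (t + 1) + f (t - 1) - 2 * f t) =
      n * f (n + 1) - (n + 1) * f n := by
    intro n
    induction n with
    | zero => simp [h0]
    | succ n ih =>
      rw [Finset.sum_Icc_succ_top (by omega), ih]
      push_cast
      rw [add_sub_cancel_right]
      ring
  -- Up to t = s the weight is t and `h1` applies; beyond s the weight is constant and the sum
  -- telescopes.
  have h2 : ∑ t ∈ Finset.Icc 1 n, min (s : ℚ) t * (f (t + 1) + f (t - 1) - 2 * f t) =
      s * (f (n + 1) - f n) - f s := by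
    induction n, hs using Nat.le_induction with
    | base =>
      rw [Finset.sum_congr rfl fun t ht => by
        rw [min_eq_right (Nat.cast_le.2 (Finset.mem_Icc.1 ht).2)], h1]
      ring
    | succ n hn ih =>
      rw [Finset.sum_Icc_succ_top (by omega), ih, min_eq_left (Nat.cast_le.2 (by omega))]
      push_cast
      rw [add_sub_cancel_right]
      ring
  have h3 : ∀ t ∈ Finset.Icc 1 n, ((2 * n + 1) * min (s : ℚ) t - 2 * s * t) *
      (f (t + 1) + f (t - 1) - 2 * f t) =
      (2 * n + 1) * (min (s : ℚ) t * (f (t + 1) + f (t - 1) - 2 * f t)) -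
      2 * s * (t * (f (t + 1) + f (t - 1) - 2 * f t)) := fun t _ => by ring
  rw [Finset.sum_congr rfl h3, Finset.sum_sub_distrib, ← Finset.mul_sum, ← Finset.mul_sum, h1, h2]
  ring

/-- The central binomial polynomial `binom(X + m, 2m + 1)`. -/
noncomputable def centralBinom : ℕ → ℚ[X]
  | 0 => X
  | m + 1 => centralBinom m * (C (1 / ((2 * m + 2) * (2 * m + 3) : ℚ)) *
      (X ^ 2 - C ((m + 1 : ℚ) ^ 2)))

theorem eval_centralBinom_succ (m : ℕ) (x : ℚ) : (centralBinom (m + 1)).eval x =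
    (centralBinom m).eval x * ((x ^ 2 - (m + 1) ^ 2) / ((2 * m + 2) * (2 * m + 3))) := by
  rw [centralBinom]
  simp only [eval_mul, eval_sub, eval_C, eval_X, eval_pow]
  ring

theorem centralBinom_eval_zero (m : ℕ) : (centralBinom m).eval 0 = 0 := by
  induction m with
  | zero => simp [centralBinom]
  | succ m ih => rw [eval_centralBinom_succ, ih, zero_mul]

/-- β_m(x) is (x-m)⋯(x+m) / (2m+1)!, so a unit shift only trades the factor x - m for x + m + 1. -/
theorem centralBinom_shift (m : ℕ) (x : ℚ) :
    (x - m) * (centralBinom m).eval (x + 1) = (x + m + 1) * (centralBinom m).eval x := by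
  induction m with
  | zero => simp [centralBinom]; ring
  | succ m ih =>
    rw [eval_centralBinom_succ, eval_centralBinom_succ]
    push_cast
    linear_combination ((x - m - 1) * (x + m + 2) / ((2 * m + 2) * (2 * m + 3))) * ih

theorem centralBinom_succ_add_one (m : ℕ) (x : ℚ) : (centralBinom (m + 1)).eval (x + 1) =
    (centralBinom m).eval x * ((x + m + 1) * (x + m + 2) / ((2 * m + 2) * (2 * m + 3))) := by
  rw [eval_centralBinom_succ]
  linear_combination ((x + m + 2) / ((2 * m + 2) * (2 * m + 3))) * centralBinom_shift m x

theorem centralBinom_succ_sub_one (m : ℕ) (x : ℚ) : (centralBinom (m + 1)).eval (x - 1) =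
    (centralBinom m).eval x * ((x - m - 1) * (x - m - 2) / ((2 * m + 2) * (2 * m + 3))) := by
  have h := centralBinom_shift m (x - 1)
  rw [sub_add_cancel] at h
  rw [eval_centralBinom_succ]
  linear_combination (-(x - m - 2) / ((2 * m + 2) * (2 * m + 3))) * h

theorem centralBinom_second_difference (m : ℕ) (x : ℚ) :
    (centralBinom (m + 1)).eval (x + 1) + (centralBinom (m + 1)).eval (x - 1) -
      2 * (centralBinom (m + 1)).eval x = (centralBinom m).eval x := by
  rw [centralBinom_succ_add_one, centralBinom_succ_sub_one, eval_centralBinom_succ]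
  have h2 : (2 * m + 2 : ℚ) ≠ 0 := by positivity
  have h3 : (2 * m + 3 : ℚ) ≠ 0 := by positivity
  field_simp
  ring

/-- The polynomial `V` with `(2x + 1) V((2x + 1)²) = β(x) + β(x + 1)`, where
`β = centralBinom (m + 1)`. -/
noncomputable def boundaryPoly : ℕ → ℚ[X]
  | 0 => C (1 / 24) * (X - C 1)
  | m + 1 => boundaryPoly m * (C (1 / (4 * ((2 * m + 4) * (2 * m + 5))) : ℚ) *
      (X - C ((2 * m + 3 : ℚ) ^ 2)))

/-- The factors of β_m(x)(x+m+1) pair up as (x-i)(x+i+1) = ((2x+1)² - (2i+1)²) / 4, whence a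
polynomial in (2x+1)². At x = n this square is p². -/
theorem boundaryPoly_eval (m : ℕ) (x : ℚ) : (boundaryPoly m).eval ((2 * x + 1) ^ 2) =
    (centralBinom m).eval x * ((x + m + 1) / ((2 * m + 2) * (2 * m + 3))) := by
  induction m with
  | zero => simp [boundaryPoly, centralBinom]; ring
  | succ m ih =>
    rw [boundaryPoly, eval_mul, ih, eval_centralBinom_succ]
    simp only [eval_mul, eval_sub, eval_C, eval_X]
    push_cast
    have h2 : (2 * m + 2 : ℚ) ≠ 0 := by positivity
    have h3 : (2 * m + 3 : ℚ) ≠ 0 := by positivity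
    have h4 : (2 * m + 4 : ℚ) ≠ 0 := by positivity
    have h5 : (2 * m + 5 : ℚ) ≠ 0 := by positivity
    rw [show (2 * ((m : ℚ) + 1) + 2) = 2 * m + 4 by ring,
      show (2 * ((m : ℚ) + 1) + 3) = 2 * m + 5 by ring]
    field_simp
    ring

theorem centralBinom_boundary (m : ℕ) (x : ℚ) :
    (centralBinom (m + 1)).eval x + (centralBinom (m + 1)).eval (x + 1) =
      (2 * x + 1) * (boundaryPoly m).eval ((2 * x + 1) ^ 2) := by
  rw [boundaryPoly_eval, eval_centralBinom_succ, centralBinom_succ_add_one]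
  ring

theorem sum_green_kernel_centralBinom (m n s : ℕ) (hs : s ≤ n) :
    ∑ t ∈ Finset.Icc 1 n, ((2 * n + 1) * min (s : ℚ) t - 2 * s * t) *
      (centralBinom m).eval (t : ℚ) = (2 * n + 1) * (s * (boundaryPoly m).eval ((2 * n + 1 : ℚ) ^ 2) -
        (centralBinom (m + 1)).eval (s : ℚ)) := by
  have h := sum_green_kernel (fun x => (centralBinom (m + 1)).eval x)
    (centralBinom_eval_zero _) n s hs
  simp only [centralBinom_second_difference] at h
  rw [h, centralBinom_boundary]
  ring

/-! ### Closed formula for the dimension -/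

/-- The polynomials in `p²` that are the coefficients of the dimension in the basis
`centralBinom`. -/
noncomputable def dimCoeff : ℕ → ℚ[X]
  | 0 => 1
  | r + 1 => ∑ m : Fin (r + 1), C ((-1 : ℚ) ^ (m : ℕ)) *
      (dimCoeff (r - m) * boundaryPoly m)
decreasing_by omega

theorem dimCoeff_succ (r : ℕ) : dimCoeff (r + 1) =
    ∑ m ∈ Finset.range (r + 1), C ((-1 : ℚ) ^ m) * (dimCoeff (r - m) * boundaryPoly m) := by
  rw [dimCoeff, Fin.sum_univ_eq_sum_range
    (fun m => C ((-1 : ℚ) ^ m) * (dimCoeff (r - m) * boundaryPoly m))]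

theorem verlindeDim_formula (n r s : ℕ) (hs1 : 1 ≤ s) (hs : s ≤ n) :
    (verlindeDim (2 * n + 1) (r + 1) (2 * n - 2 * s) : ℚ) =
      (2 * n + 1) ^ r * ∑ m ∈ Finset.range (r + 1), (-1) ^ m *
        (dimCoeff (r - m)).eval ((2 * n + 1 : ℚ) ^ 2) * (centralBinom m).eval (s : ℚ) := by
  induction r generalizing s with
  | zero => simp [verlindeDim_one n s hs1 hs, dimCoeff, centralBinom]
  | succ r ih =>
    -- Each β_m term yields a β_{m+1} term and a boundary multiple of s. The boundary parts add up
    -- to the β_0 term, which is the recursion defining `dimCoeff (r + 1)`.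
    rw [verlindeDim_succ n (r + 1) s hs1 hs, Finset.sum_congr rfl fun t ht => by
      rw [ih t (Finset.mem_Icc.1 ht).1 (Finset.mem_Icc.1 ht).2, Finset.mul_sum, Finset.mul_sum],
      Finset.sum_comm, Finset.sum_range_succ' _ (r + 1), Nat.sub_zero, dimCoeff_succ,
      eval_finsetSum, Finset.mul_sum, Finset.sum_mul, ← Finset.sum_add_distrib, Finset.mul_sum]
    refine Finset.sum_congr rfl fun m _ => ?_
    have h := sum_green_kernel_centralBinom m n s hs
    have h' : ∀ t ∈ Finset.Icc 1 n, ((2 * n + 1) * min (s : ℚ) t - 2 * s * t) *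
        ((2 * n + 1) ^ r * ((-1) ^ m * (dimCoeff (r - m)).eval ((2 * n + 1 : ℚ) ^ 2) *
          (centralBinom m).eval (t : ℚ))) =
        ((2 * n + 1) ^ r * ((-1) ^ m * (dimCoeff (r - m)).eval ((2 * n + 1 : ℚ) ^ 2))) *
          (((2 * n + 1) * min (s : ℚ) t - 2 * s * t) * (centralBinom m).eval (t : ℚ)) :=
      fun t _ => by ring
    rw [Finset.sum_congr rfl h', ← Finset.mul_sum, h, Nat.add_sub_add_right, show centralBinom 0 = X from rfl]
    simp only [eval_mul, eval_C, eval_X]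
    ring

/-! ### Top coefficients -/

theorem boundaryPoly_natDegree_le (m : ℕ) : (boundaryPoly m).natDegree ≤ m + 1 := by
  induction m with
  | zero => rw [boundaryPoly]; compute_degree
  | succ m ih =>
    rw [boundaryPoly]
    refine natDegree_mul_le_of_le ih ?_
    compute_degree

theorem boundaryPoly_coeff (m : ℕ) :
    (boundaryPoly m).coeff (m + 1) = 1 / (4 ^ (m + 1) * (2 * m + 3).factorial) := by
  induction m with
  | zero => simp [boundaryPoly, Nat.factorial, coeff_one]; norm_num
  | succ m ih =>
    rw [boundaryPoly, coeff_mul_add_eq_of_natDegree_le (boundaryPoly_natDegree_le m) (dg := 1)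
      (by compute_degree), ih, coeff_C_mul, coeff_sub, coeff_X_one, coeff_C_of_ne_zero one_ne_zero,
      show 2 * (m + 1) + 3 = 2 * m + 3 + 1 + 1 by ring,
      Nat.factorial_succ (2 * m + 3 + 1), Nat.factorial_succ (2 * m + 3)]
    generalize (2 * m + 3).factorial = N
    push_cast
    rw [mul_sub, mul_zero, sub_zero, mul_one, one_div_mul_one_div]
    ring

theorem dimCoeff_natDegree_le (r : ℕ) : (dimCoeff r).natDegree ≤ r := by
  induction r using Nat.strong_induction_on with
  | _ r ih =>
    cases r with
    | zero => simp [dimCoeff]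
    | succ r =>
      rw [dimCoeff_succ]
      refine natDegree_sum_le_of_forall_le _ _ fun m hm => ?_
      rw [Finset.mem_range] at hm
      refine (natDegree_C_mul_le _ _).trans ((natDegree_mul_le_of_le (ih (r - m) (by omega))
        (boundaryPoly_natDegree_le m)).trans (by omega))

/-- With c_0 = 1, this recursion says (∑ c_r z^{2r}) sin(z/2) = z/2. -/
theorem dimCoeff_coeff_succ (r : ℕ) : (dimCoeff (r + 1)).coeff (r + 1) =
    ∑ m ∈ Finset.range (r + 1), (-1) ^ m * ((dimCoeff (r - m)).coeff (r - m) /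
      (4 ^ (m + 1) * (2 * m + 3).factorial)) := by
  rw [dimCoeff_succ, finsetSum_coeff]
  refine Finset.sum_congr rfl fun m hm => ?_
  rw [Finset.mem_range] at hm
  rw [coeff_C_mul]
  congr 1
  have := coeff_mul_add_eq_of_natDegree_le (dimCoeff_natDegree_le (r - m)) (boundaryPoly_natDegree_le m)
  rw [show r - m + (m + 1) = r + 1 by omega] at this
  rw [this, boundaryPoly_coeff]
  ring

/-! ### Positivity of the top coefficients -/

/-- A strictly concave function vanishing at both ends is positive between them. By Rolle f' has an
interior zero, and f' decreases strictly, so f'(0) > 0. -/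
theorem pos_of_second_deriv_neg {f f' h : ℝ → ℝ} {b : ℝ} (hb : 0 < b)
    (hf : ∀ x, HasDerivAt f (f' x) x)
    (hf' : ∀ x, HasDerivAt f' (-h x) x) (hh : ∀ x ∈ Set.Ioo 0 b, 0 < h x)
    (h0 : f 0 = 0) (h1 : f b = 0) : 0 < f' 0 ∧ ∀ x ∈ Set.Ioo 0 b, 0 < f x := by
  have hanti : StrictAntiOn f' (Set.Icc 0 b) := by
    refine strictAntiOn_of_deriv_neg (convex_Icc _ _)
      (fun x _ => (hf' x).continuousAt.continuousWithinAt) fun x hx => ?_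
    rw [interior_Icc] at hx
    rw [(hf' x).deriv]
    linarith [hh x hx]
  have hcont : ContinuousOn f (Set.Icc 0 b) := fun x _ => (hf x).continuousAt.continuousWithinAt
  obtain ⟨ξ, hξ, hξ0⟩ := exists_hasDerivAt_eq_zero hb hcont (h0.trans h1.symm) fun x _ => hf x
  have hξ' := Set.Ioo_subset_Icc_self hξ
  refine ⟨hξ0 ▸ hanti (Set.left_mem_Icc.2 hb.le) hξ' hξ.1, fun x hx => ?_⟩
  have hder : deriv f = f' := funext fun x => (hf x).deriv
  have hconc : StrictConcaveOn ℝ (Set.Icc 0 b) f := by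
    refine StrictAntiOn.strictConcaveOn_of_deriv (convex_Icc _ _) hcont ?_
    rw [hder, interior_Icc]
    exact hanti.mono Set.Ioo_subset_Icc_self
  have := hconc.lt_on_openSegment (Set.left_mem_Icc.2 hb.le) (Set.right_mem_Icc.2 hb.le) hb.ne
    (by rwa [openSegment_eq_Ioo hb])
  rwa [h0, h1, min_self] at this

/-- The coefficient of `z ^ (2r + 1)` in the product of `∑ c k z ^ (2k)` and `sin (z x)`. -/
noncomputable def oddTaylor (c : ℕ → ℝ) (r : ℕ) (x : ℝ) : ℝ :=
  ∑ m ∈ Finset.range (r + 1), (-1) ^ m * c (r - m) * (x ^ (2 * m + 1) / (2 * m + 1).factorial)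

/-- The derivative of `oddTaylor c r`. -/
noncomputable def evenTaylor (c : ℕ → ℝ) (r : ℕ) (x : ℝ) : ℝ :=
  ∑ m ∈ Finset.range (r + 1), (-1) ^ m * c (r - m) * (x ^ (2 * m) / (2 * m).factorial)

theorem hasDerivAt_pow_div_factorial (k : ℕ) (x : ℝ) :
    HasDerivAt (fun x : ℝ => x ^ (k + 1) / (k + 1).factorial) (x ^ k / k.factorial) x := by
  refine ((hasDerivAt_pow (k + 1) x).div_const _).congr_deriv ?_
  rw [Nat.factorial_succ]
  have := Nat.factorial_ne_zero k
  push_cast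
  field_simp

theorem hasDerivAt_oddTaylor (c : ℕ → ℝ) (r : ℕ) (x : ℝ) :
    HasDerivAt (oddTaylor c r) (evenTaylor c r x) x := by
  unfold oddTaylor evenTaylor
  exact HasDerivAt.fun_sum fun m _ => (hasDerivAt_pow_div_factorial (2 * m) x).const_mul _

theorem hasDerivAt_evenTaylor (c : ℕ → ℝ) (r : ℕ) (x : ℝ) :
    HasDerivAt (evenTaylor c (r + 1)) (-oddTaylor c r x) x := by
  have h : evenTaylor c (r + 1) = fun x => (∑ m ∈ Finset.range (r + 1),
      (-1) ^ (m + 1) * c (r - m) * (x ^ (2 * m + 1 + 1) / (2 * m + 1 + 1).factorial)) +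
        c (r + 1) := by
    funext x
    rw [evenTaylor, Finset.sum_range_succ']
    simp [mul_add]
  rw [h]
  have := HasDerivAt.fun_sum (u := Finset.range (r + 1)) fun m _ =>
    (hasDerivAt_pow_div_factorial (2 * m + 1) x).const_mul ((-1) ^ (m + 1) * c (r - m))
  refine (this.add_const (c (r + 1))).congr_deriv ?_
  rw [oddTaylor, ← Finset.sum_neg_distrib]
  refine Finset.sum_congr rfl fun m _ => ?_
  ring

/-- F_r = `oddTaylor c r` satisfies F_{r+1}'' = -F_r and F_{r+1}'(0) = c_{r+1}. It vanishes at 0,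
and the recursion says exactly that F_{r+1}(1/2) = 0. Positivity of F_r on (0, 1/2) thus passes to
F_{r+1} and to c_{r+1}. -/
theorem coeff_pos_of_recursion (c : ℕ → ℝ) (h0 : 0 < c 0)
    (hc : ∀ r, c (r + 1) = ∑ m ∈ Finset.range (r + 1),
      (-1) ^ m * (c (r - m) / (4 ^ (m + 1) * (2 * m + 3).factorial))) (r : ℕ) :
    0 < c r ∧ ∀ x ∈ Set.Ioo (0 : ℝ) (1 / 2), 0 < oddTaylor c r x := by
  induction r with
  | zero =>
    refine ⟨h0, fun x hx => ?_⟩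
    simpa [oddTaylor] using mul_pos h0 hx.1
  | succ r ih =>
    have h := pos_of_second_deriv_neg (by norm_num) (hasDerivAt_oddTaylor c (r + 1))
      (hasDerivAt_evenTaylor c r) ih.2 (by simp [oddTaylor]) ?_
    · refine ⟨?_, h.2⟩
      have h1 := h.1
      rw [evenTaylor, Finset.sum_range_succ'] at h1
      simpa using h1
    · rw [oddTaylor, Finset.sum_range_succ', Nat.sub_zero, hc, Finset.mul_sum, Finset.sum_mul,
        ← Finset.sum_add_distrib]
      refine Finset.sum_eq_zero fun m _ => ?_
      rw [Nat.add_sub_add_right, show 2 * (m + 1) + 1 = 2 * m + 3 by ring,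
        show (4 : ℝ) = 2 ^ 2 by norm_num, ← pow_mul]
      have := Nat.factorial_ne_zero (2 * m + 3)
      simp only [one_div, inv_pow]
      field_simp
      ring

theorem dimCoeff_coeff_pos (r : ℕ) : 0 < (dimCoeff r).coeff r := by
  have := (coeff_pos_of_recursion (fun r => ((dimCoeff r).coeff r : ℝ)) (by simp [dimCoeff])
    (fun r => by rw [dimCoeff_coeff_succ]; push_cast; rfl) r).1
  exact_mod_cast this

/-! ### Coefficients of the powers of p and their degrees -/

theorem centralBinom_degree (m : ℕ) : (centralBinom m).degree = (2 * m + 1 : ℕ) := by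
  induction m with
  | zero => simp [centralBinom]
  | succ m ih =>
    rw [centralBinom, degree_mul, ih, degree_C_mul (by positivity),
      degree_X_pow_sub_C (by norm_num)]
    norm_cast

/-- The coefficient of `p ^ (r + 2 * k)` in the dimension, a polynomial in `s`. -/
noncomputable def verlindePoly (r k : ℕ) : ℚ[X] :=
  ∑ m ∈ Finset.range (r + 1), C ((-1) ^ m * (dimCoeff (r - m)).coeff k) * centralBinom m

theorem verlindePoly_degree (r k : ℕ) (hk : k ≤ r) :
    (verlindePoly r k).degree = (2 * (r - k) + 1 : ℕ) := by
  obtain ⟨d, rfl⟩ := Nat.exists_eq_add_of_le hk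
  have h : verlindePoly (k + d) k = ∑ m ∈ Finset.range (d + 1),
      C ((-1) ^ m * (dimCoeff (k + d - m)).coeff k) * centralBinom m := by
    -- For m > d the polynomial `dimCoeff (k + d - m)` has degree below k, so these terms vanish.
    refine (Finset.sum_subset (Finset.range_subset_range.2 (by omega)) fun m hm hm' => ?_).symm
    rw [Finset.mem_range] at hm hm'
    rw [coeff_eq_zero_of_natDegree_lt ((dimCoeff_natDegree_le _).trans_lt (by omega)), mul_zero,
      C_0, zero_mul]
  -- The last term m = d carries the top coefficient of `dimCoeff k`, which is positive; all earlier
  -- terms have smaller degree.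
  have htop : (C ((-1) ^ d * (dimCoeff (k + d - d)).coeff k) * centralBinom d).degree =
      (2 * d + 1 : ℕ) := by
    rw [Nat.add_sub_cancel, degree_C_mul, centralBinom_degree]
    exact mul_ne_zero (pow_ne_zero _ (by norm_num)) (dimCoeff_coeff_pos k).ne'
  rw [h, Finset.sum_range_succ, Nat.add_sub_cancel_left, degree_add_eq_right_of_degree_lt, htop]
  rw [htop]
  refine (degree_sum_le _ _).trans_lt ?_
  rw [Finset.sup_lt_iff (WithBot.bot_lt_coe _)]
  intro m hm
  rw [Finset.mem_range] at hm
  rw [← smul_eq_C_mul]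
  refine (degree_smul_le _ _).trans_lt ?_
  rw [centralBinom_degree]
  exact_mod_cast (by omega : 2 * m + 1 < 2 * d + 1)

theorem verlindeDim_eq_sum_verlindePoly (n r s : ℕ) (hs1 : 1 ≤ s) (hs : s ≤ n) :
    (verlindeDim (2 * n + 1) (r + 1) (2 * n - 2 * s) : ℚ) =
      ∑ k ∈ Finset.range (r + 1), (verlindePoly r k).eval (s : ℚ) *
        (2 * n + 1 : ℚ) ^ (r + 2 * k) := by
  rw [verlindeDim_formula n r s hs1 hs, Finset.mul_sum]
  simp only [verlindePoly, eval_finsetSum, Finset.sum_mul]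
  rw [Finset.sum_comm]
  refine Finset.sum_congr rfl fun m _ => ?_
  rw [eval_eq_sum_range' (n := r + 1) ((dimCoeff_natDegree_le (r - m)).trans_lt (by omega)),
    Finset.mul_sum, Finset.sum_mul, Finset.mul_sum]
  refine Finset.sum_congr rfl fun k _ => ?_
  rw [eval_mul, eval_C, ← pow_mul, pow_add]
  ring

theorem mainTheorem8 (g : ℕ) (hg : 1 ≤ g) :
    ∃ φ : ℕ → ℚ[X],
      (∀ j ∈ exponentSet g, (φ j).degree = ((3 * g - 2 - j : ℕ) : WithBot ℕ)) ∧
      ∀ p : ℕ, Odd p → 3 ≤ p →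
        ∀ s : ℕ, 1 ≤ s → s ≤ (p - 1) / 2 →
          (verlindeDim p g (p - 2 * s - 1) : ℚ) =
            ∑ j ∈ exponentSet g, (φ j).eval (s : ℚ) * (p : ℚ) ^ j := by
  obtain ⟨r, rfl⟩ : ∃ r, g = r + 1 := ⟨g - 1, by omega⟩
  -- On the exponent set j = r + 2k, so (j - r) / 2 recovers k.
  refine ⟨fun j => verlindePoly r ((j - r) / 2), fun j hj => ?_, fun p hp _ s hs1 hs => ?_⟩
  · obtain ⟨k, hk, rfl⟩ := Finset.mem_image.1 hj
    rw [Finset.mem_range] at hk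
    simp only [Nat.add_sub_cancel, Nat.add_sub_cancel_left]
    rw [Nat.mul_div_cancel_left k (by norm_num), verlindePoly_degree r k (by omega)]
    congr 1
    omega
  · obtain ⟨n, rfl⟩ := hp
    rw [show 2 * n + 1 - 2 * s - 1 = 2 * n - 2 * s by omega,
      verlindeDim_eq_sum_verlindePoly n r s hs1 (by omega), exponentSet,
      Finset.sum_image fun a _ b _ h => by simpa using h]
    refine Finset.sum_congr rfl fun k _ => ?_
    simp only [Nat.add_sub_cancel, Nat.add_sub_cancel_left]
    rw [Nat.mul_div_cancel_left k (by norm_num)]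
    push_cast
    rfl
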